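/- A topological dynamical system (TDS) $(X,T)$ is a compact metrizable space $X$ with a continuous map $T\colon X\to X$; let $d$ be a metric inducing the topology of $X$. It is minimal if every non-empty closed $K\subseteq X$ with $T(K)\subseteq K$ equals $X$. A pair $(x,y)\in X^2$ is regionally proximal if for every $\varepsilon>0$ there are $x',y'\in X$ and an integer $n\ge 0$ with $d(x,x')\le\varepsilon$, $d(y,y')\le\varepsilon$ and $d(T^nx',T^ny')\le\varepsilon$; let $\mathcal{Q}_X(T)\subseteq X^2$ be the (closed) set of regionally proximal pairs. Call $(X,T)$ $\mathcal{Q}$-full if $\mathcal{Q}_X(T)=X^2$, and $\mathcal{Q}$-realizable if the smallest closed $T\times T$-invariant equivalence relation on $X$ containing $\mathcal{Q}_X(T)$ is $X^2$. **Proposition 4.11.** A minimal TDS is $\mathcal{Q}$-full if and only if it is $\mathcal{Q}$-realizable. -/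

import Mathlib

namespace TDS

open TopologicalSpace

/-- `(X, T)` is minimal: the only non-empty closed `K ⊆ X` with `T(K) ⊆ K` is `X` itself. -/
def IsMinimal {X : Type*} [TopologicalSpace X] (T : C(X, X)) : Prop :=
  ∀ K : Set X, K.Nonempty → IsClosed K → T '' K ⊆ K → K = Set.univ

/-- `R` is a closed `T × T`-invariant equivalence relation on `X`. -/
structure IsClosedInvariant {X : Type*} [TopologicalSpace X] (T : C(X, X)) (R : Setoid X) :
    Prop where
  closed : IsClosed {p : X × X | R p.1 p.2}
  invariant : ∀ x y, R x y → R (T x) (T y)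

/-- The smallest closed `T × T`-invariant equivalence relation on `X` containing `F ⊆ X × X`
(the infimum of setoids is the intersection of the relations). -/
def icer {X : Type*} [TopologicalSpace X] (T : C(X, X)) (F : Set (X × X)) : Setoid X :=
  sInf {R : Setoid X | IsClosedInvariant T R ∧ ∀ p ∈ F, R p.1 p.2}

theorem icer_isLeast {X : Type*} [TopologicalSpace X] (T : C(X, X)) (F : Set (X × X)) :
    IsLeast {R : Setoid X | IsClosedInvariant T R ∧ ∀ p ∈ F, R p.1 p.2} (icer T F) := by
  refine ⟨⟨⟨?_, ?_⟩, ?_⟩, fun R hR => sInf_le hR⟩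
  · have : {p : X × X | icer T F p.1 p.2} =
        ⋂ R ∈ {R : Setoid X | IsClosedInvariant T R ∧ ∀ p ∈ F, R p.1 p.2},
          {p : X × X | R p.1 p.2} := by
      ext p
      simp only [Set.mem_iInter]
      exact Iff.rfl
    rw [this]
    exact isClosed_biInter fun R hR => hR.1.closed
  · exact fun x y h R hR => hR.1.invariant x y (h R hR)
  · exact fun p hp R hR => hR.2 p hp

/-- `(X, T)` is `P`-full, for an assignment `P` of a compact set of pairs to each continuous
self-map of `X`: `P(T) = X × X`. -/
def IsFull {X : Type*} [TopologicalSpace X] (P : C(X, X) → Compacts (X × X)) (T : C(X, X)) :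
    Prop :=
  (P T : Set (X × X)) = Set.univ

/-- `(X, T)` is `P`-realizable: the smallest closed `T × T`-invariant equivalence relation
containing `P(T)` is `X × X`. -/
def IsRealizable {X : Type*} [TopologicalSpace X] (P : C(X, X) → Compacts (X × X))
    (T : C(X, X)) : Prop :=
  icer T (P T : Set (X × X)) = ⊤

/-- `(x, y)` is a regionally proximal pair of `(X, T)`. -/
def IsRegionallyProximal {X : Type*} [MetricSpace X] (T : C(X, X)) (x y : X) : Prop :=
  ∀ ε : ℝ, 0 < ε → ∃ x' y' : X, ∃ n : ℕ,
    dist x x' ≤ ε ∧ dist y y' ≤ ε ∧ dist (T^[n] x') (T^[n] y') ≤ ε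

theorem isClosed_regionallyProximal {X : Type*} [MetricSpace X] (T : C(X, X)) :
    IsClosed {p : X × X | IsRegionallyProximal T p.1 p.2} := by
  refine isClosed_of_closure_subset fun p hp ε hε => ?_
  obtain ⟨q, hq, hpq⟩ := Metric.mem_closure_iff.1 hp (ε / 2) (by positivity)
  obtain ⟨x', y', n, h1, h2, h3⟩ := hq (ε / 2) (by positivity)
  rw [Prod.dist_eq, max_lt_iff] at hpq
  refine ⟨x', y', n, ?_, ?_, by linarith⟩
  · linarith [dist_triangle p.1 q.1 x', hpq.1]
  · linarith [dist_triangle p.2 q.2 y', hpq.2]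

/-- The regionally proximal pair assignment `Q` on a compact metric space `X`. -/
def regProx (X : Type*) [MetricSpace X] [CompactSpace X] (T : C(X, X)) : Compacts (X × X) where
  carrier := {p : X × X | IsRegionallyProximal T p.1 p.2}
  isCompact' := (isClosed_regionallyProximal T).isCompact

end TDS

/-! Only realizable ⇒ full needs work. Fix an invariant probability measure `μ`; minimality gives it
full support. If `W ⊆ X × X` is closed and forward invariant, with sections `W_x`, then `D x y = μ
(W_x ∆ W_y)` is a continuous invariant pseudometric. It vanishes on regionally proximal pairs, so
realizability forces `D = 0`: all sections agree up to null sets. Take for `W` the closure of the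
forward orbit of a product of balls around `x` and `y`. Its section at `x` contains the ball around
`y`, hence so does every section, by closedness and full support. So `(y, y) ∈ W`: some pair from
the product is carried close to `(y, y)`. -/

namespace TDS

open MeasureTheory Filter Topology Set
open scoped symmDiff BoundedContinuousFunction

section InvariantMeasure

variable {X : Type*} [MetricSpace X] [CompactSpace X] [MeasurableSpace X]

/-- The uniform probability measure on the first `n + 1` points of the orbit of `x`. -/
noncomputable def orbitMeasure (T : X → X) (x : X) (n : ℕ) : Measure X :=
  ENNReal.ofReal ((n + 1 : ℕ) : ℝ)⁻¹ • ∑ k ∈ Finset.range (n + 1), Measure.dirac (T^[k] x)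

instance isProbabilityMeasure_orbitMeasure (T : X → X) (x : X) (n : ℕ) :
    IsProbabilityMeasure (orbitMeasure T x n) := by
  constructor
  have h : (0 : ℝ) < ((n + 1 : ℕ) : ℝ) := by positivity
  simp only [orbitMeasure, Measure.smul_apply, Measure.finsetSum_apply, measure_univ,
    Finset.sum_const, Finset.card_range, smul_eq_mul, nsmul_eq_mul, mul_one]
  rw [ENNReal.ofReal_inv_of_pos h, ENNReal.ofReal_natCast]
  exact ENNReal.inv_mul_cancel (by simp) (ENNReal.natCast_ne_top _)

theorem integral_orbitMeasure [BorelSpace X] (T : X → X) (x : X) (n : ℕ) (f : X →ᵇ ℝ) :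
    ∫ y, f y ∂(orbitMeasure T x n) = birkhoffAverage ℝ T f (n + 1) x := by
  have h : (0 : ℝ) ≤ ((n + 1 : ℕ) : ℝ)⁻¹ := by positivity
  rw [orbitMeasure, integral_smul_measure, integral_finsetSum_measure, ENNReal.toReal_ofReal h]
  · simp [birkhoffAverage, birkhoffSum]
  · exact fun _ _ => f.integrable _

/-- **Krylov–Bogoliubov theorem**: a continuous self-map of a non-empty compact metric space has
an invariant Borel probability measure. -/
theorem exists_isProbabilityMeasure_measurePreserving [BorelSpace X] [Nonempty X] (T : C(X, X)) :
    ∃ μ : Measure X, IsProbabilityMeasure μ ∧ MeasurePreserving T μ μ := by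
  obtain ⟨x⟩ := ‹Nonempty X›
  let u : ℕ → ProbabilityMeasure X := fun n => ⟨orbitMeasure T x n, inferInstance⟩
  obtain ⟨μ, -, hμ⟩ := isCompact_univ.ultrafilter_le_nhds ((hyperfilter ℕ).map u) (by simp)
  have hu : Tendsto u (hyperfilter ℕ) (𝓝 μ) := hμ
  rw [ProbabilityMeasure.tendsto_iff_forall_integral_tendsto] at hu
  have hat : (hyperfilter ℕ : Filter ℕ) ≤ atTop := Nat.hyperfilter_le_atTop
  refine ⟨μ, inferInstance, T.continuous.measurable, ?_⟩
  have := Measure.isProbabilityMeasure_map (μ := (μ : Measure X))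
    T.continuous.measurable.aemeasurable
  refine ext_of_forall_integral_eq_of_IsFiniteMeasure fun f => ?_
  rw [integral_map T.continuous.measurable.aemeasurable f.continuous.aestronglyMeasurable]
  have h1 := hu f
  have h2 := hu (f.compContinuous T)
  -- Averages started at `T x` and at `x` differ only by two boundary terms divided by the length.
  have h3 := ((tendsto_birkhoffAverage_apply_sub_birkhoffAverage' ℝ f.isBounded_range T x).comp
    (tendsto_add_atTop_nat 1)).mono_left hat
  refine tendsto_nhds_unique h2 ?_
  have h4 := h3.add h1
  rw [zero_add] at h4
  refine h4.congr fun n => ?_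
  change _ + ∫ y, f y ∂(orbitMeasure T x n) = ∫ y, f.compContinuous T y ∂(orbitMeasure T x n)
  rw [integral_orbitMeasure, integral_orbitMeasure]
  have h5 : ∀ k, f (T^[k] (T x)) = f.compContinuous T (T^[k] x) := fun k => by
    rw [← Function.iterate_succ_apply, Function.iterate_succ_apply',
      BoundedContinuousFunction.compContinuous_apply]
  simp only [Function.comp_apply, birkhoffAverage, birkhoffSum, h5, sub_add_cancel]

/-- The support of an invariant measure is non-empty, closed and forward invariant. -/
theorem IsMinimal.isOpenPosMeasure {T : C(X, X)} (hT : IsMinimal T) {μ : Measure X}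
    [IsProbabilityMeasure μ] (hμ : MeasurePreserving T μ μ) : μ.IsOpenPosMeasure := by
  have hsupp : μ.support = univ := by
    refine hT _ (Measure.nonempty_support (IsProbabilityMeasure.ne_zero μ))
      Measure.isClosed_support ?_
    rw [image_subset_iff]
    exact Measure.support_subset_of_isClosed (Measure.isClosed_support.preimage T.continuous)
      (hμ.quasiMeasurePreserving.ae Measure.support_mem_ae)
  refine ⟨fun U hU ⟨x, hx⟩ => ?_⟩
  exact ((Measure.mem_support_iff_forall x).1 (hsupp ▸ mem_univ x) U (hU.mem_nhds hx)).ne'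

end InvariantMeasure

section Pseudometric

variable {X : Type*} [MetricSpace X] {T : C(X, X)}

theorem continuous_of_tendsto_diagonal {D : X → X → ℝ} (symm : ∀ x y, D x y = D y x)
    (tri : ∀ x y z, D x z ≤ D x y + D y z) (lim : ∀ x, Tendsto (fun y => D y x) (𝓝 x) (𝓝 0)) :
    Continuous fun p : X × X => D p.1 p.2 := by
  refine continuous_iff_continuousAt.2 fun ⟨x, y⟩ => ?_
  have h : Tendsto (fun p : X × X => D p.1 x + D p.2 y) (𝓝 (x, y)) (𝓝 0) := by
    simpa using ((lim x).comp (continuous_fst.tendsto (x, y))).add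
      ((lim y).comp (continuous_snd.tendsto (x, y)))
  refine tendsto_iff_dist_tendsto_zero.2 (squeeze_zero (fun _ => dist_nonneg) (fun p => ?_) h)
  rw [Real.dist_eq, abs_le]
  constructor
  · linarith [tri x p.1 y, tri p.1 p.2 y, symm x p.1]
  · linarith [tri p.1 x p.2, tri x y p.2, symm y p.2]

/-- `D` is constant along orbits of pairs and uniformly small near the diagonal. -/
theorem IsRegionallyProximal.eq_zero [CompactSpace X] {D : X → X → ℝ} (self : ∀ x, D x x = 0)
    (nonneg : ∀ x y, 0 ≤ D x y) (cont : Continuous fun p : X × X => D p.1 p.2)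
    (inv : ∀ x y, D (T x) (T y) = D x y) {x y : X} (h : IsRegionallyProximal T x y) :
    D x y = 0 := by
  refine le_antisymm (le_of_forall_pos_le_add fun ε hε => ?_) (nonneg x y)
  obtain ⟨δ, hδ, hD⟩ := Metric.uniformContinuous_iff.1
    (CompactSpace.uniformContinuous_of_continuous cont) (ε / 2) (by positivity)
  obtain ⟨x', y', n, hx, hy, hn⟩ := h (δ / 2) (by positivity)
  have iter : D (T^[n] x') (T^[n] y') = D x' y' := by
    clear hn
    induction n with
    | zero => rfl
    | succ n ih => rw [Function.iterate_succ_apply', Function.iterate_succ_apply', inv, ih]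
  have h1 := @hD (x, y) (x', y') (by rw [Prod.dist_eq]; exact max_lt (by linarith) (by linarith))
  have h2 := @hD (T^[n] x', T^[n] y') (T^[n] y', T^[n] y')
    (by rw [Prod.dist_eq, dist_self]; exact max_lt (by linarith) hδ)
  simp only [Real.dist_eq, self, iter] at h1 h2
  linarith [(abs_lt.1 h1).2, (abs_lt.1 h2).2]

/-- On a `Q`-realizable system every continuous `T`-invariant pseudometric vanishes. -/
theorem IsRealizable.eq_zero [CompactSpace X] (h : IsRealizable (regProx X) T) {D : X → X → ℝ}
    (self : ∀ x, D x x = 0) (nonneg : ∀ x y, 0 ≤ D x y) (symm : ∀ x y, D x y = D y x)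
    (tri : ∀ x y z, D x z ≤ D x y + D y z) (cont : Continuous fun p : X × X => D p.1 p.2)
    (inv : ∀ x y, D (T x) (T y) = D x y) (x y : X) : D x y = 0 := by
  let R : Setoid X :=
    { r := fun x y => D x y = 0
      iseqv :=
        { refl := self
          symm := fun {x y} hxy => (symm y x).trans hxy
          trans := fun {x y z} hxy hyz =>
            le_antisymm (by linarith [tri x y z]) (nonneg x z) } }
  have hR : icer T (regProx X T : Set (X × X)) ≤ R :=
    (icer_isLeast T _).2 ⟨⟨isClosed_singleton.preimage cont,
      fun x y hxy => (inv x y).trans hxy⟩,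
      fun p hp => IsRegionallyProximal.eq_zero self nonneg cont inv hp⟩
  rw [h] at hR
  exact hR (show (⊤ : Setoid X) x y from trivial)

end Pseudometric

section Sections

variable {X : Type*} [MetricSpace X] {W : Set (X × X)}

theorem isClosed_section (hW : IsClosed W) (x : X) : IsClosed (Prod.mk x ⁻¹' W) :=
  hW.preimage (by fun_prop)

/-- Projection along a compact factor is a closed map. -/
theorem eventually_section_subset [CompactSpace X] (hW : IsClosed W) {x : X} {U : Set X} (hU : IsOpen U)
    (h : Prod.mk x ⁻¹' W ⊆ U) : ∀ᶠ x' in 𝓝 x, Prod.mk x' ⁻¹' W ⊆ U := by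
  have hc : IsClosed (Prod.fst '' (W ∩ Prod.snd ⁻¹' Uᶜ)) :=
    isClosedMap_fst_of_compactSpace _ (hW.inter (hU.isClosed_compl.preimage continuous_snd))
  have hx : x ∉ Prod.fst '' (W ∩ Prod.snd ⁻¹' Uᶜ) := by
    rintro ⟨⟨_, y⟩, ⟨hy, hyU⟩, rfl⟩
    exact hyU (h hy)
  filter_upwards [hc.isOpen_compl.mem_nhds hx] with x' hx' y hy
  by_contra hyU
  exact hx' ⟨(x', y), ⟨hy, hyU⟩, rfl⟩

variable [CompactSpace X] [MeasurableSpace X] [BorelSpace X] {μ : Measure X} [IsProbabilityMeasure μ]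

theorem eventually_measureReal_section_diff_lt (hW : IsClosed W) (x : X) {ε : ℝ} (hε : 0 < ε) :
    ∀ᶠ x' in 𝓝 x, μ.real (Prod.mk x' ⁻¹' W \ Prod.mk x ⁻¹' W) < ε := by
  obtain ⟨U, hWU, hU, hμU⟩ := (Prod.mk x ⁻¹' W).exists_isOpen_lt_add (μ := μ)
    (measure_ne_top _ _) (ε := ENNReal.ofReal ε) (by simpa using hε)
  filter_upwards [eventually_section_subset hW hU hWU] with x' hx'
  refine (measureReal_mono (sdiff_subset_sdiff_left hx')).trans_lt ?_
  have := measure_sdiff_lt_of_lt_add (isClosed_section hW x).nullMeasurableSet hWU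
    (measure_ne_top μ _) hμU
  exact (ENNReal.toReal_lt_toReal (measure_ne_top _ _) ENNReal.ofReal_ne_top).2 this |>.trans_eq
    (ENNReal.toReal_ofReal hε.le)

variable {T : C(X, X)} (hT : IsMinimal T) (hμ : MeasurePreserving T μ μ) (hW : IsClosed W)
  (hTW : ∀ p ∈ W, Prod.map T T p ∈ W)

-- `x ↦ μ (W_x)` is upper semicontinuous, and it cannot decrease along `T` because `W_x ⊆ T⁻¹ (W_{T
-- x})`. Its superlevel sets are therefore closed and forward invariant.
include hT hμ hW hTW in
theorem measureReal_section_eq (x y : X) :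
    μ.real (Prod.mk x ⁻¹' W) = μ.real (Prod.mk y ⁻¹' W) := by
  suffices h : ∀ x y, μ.real (Prod.mk x ⁻¹' W) ≤ μ.real (Prod.mk y ⁻¹' W) from
    le_antisymm (h x y) (h y x)
  intro x y
  have hK := hT {z | μ.real (Prod.mk x ⁻¹' W) ≤ μ.real (Prod.mk z ⁻¹' W)} ⟨x, le_refl (μ.real _)⟩ ?_ ?_
  · exact (hK ▸ mem_univ y :)
  · rw [← isOpen_compl_iff, isOpen_iff_mem_nhds]
    intro z hz
    simp only [mem_compl_iff, mem_ofPred_eq, not_le] at hz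
    filter_upwards [eventually_measureReal_section_diff_lt (μ := μ) hW z (sub_pos.2 hz)]
      with z' hz'
    have := measureReal_sdiff_add_inter (μ := μ) (s := Prod.mk z' ⁻¹' W)
      (isClosed_section hW z).measurableSet
    have := measureReal_mono (μ := μ) (inter_subset_right (s := Prod.mk z' ⁻¹' W)
      (t := Prod.mk z ⁻¹' W))
    simp only [mem_compl_iff, mem_ofPred_eq, not_le]
    linarith
  · rintro _ ⟨z, hz, rfl⟩
    rw [mem_ofPred_eq] at hz ⊢
    refine hz.trans ?_
    rw [← hμ.measureReal_preimage (isClosed_section hW (T z)).nullMeasurableSet]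
    exact measureReal_mono fun y hy => hTW _ hy

-- Sections have equal measure, so both one-sided differences have the same measure and
-- semicontinuity becomes continuity.
include hT hμ hW hTW in
theorem tendsto_measureReal_section_symmDiff (x : X) :
    Tendsto (fun x' => μ.real ((Prod.mk x' ⁻¹' W) ∆ (Prod.mk x ⁻¹' W))) (𝓝 x) (𝓝 0) := by
  refine tendsto_order.2 ⟨fun a ha => .of_forall fun _ => ha.trans_le measureReal_nonneg,
    fun ε hε => ?_⟩
  filter_upwards [eventually_measureReal_section_diff_lt (μ := μ) hW x (half_pos hε)] with x' hx'
  rw [measureReal_symmDiff_eq (isClosed_section hW _).measurableSet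
    (isClosed_section hW _).measurableSet]
  have h1 := measureReal_sdiff_add_inter (μ := μ) (s := Prod.mk x' ⁻¹' W)
    (isClosed_section hW x).measurableSet
  have h2 := measureReal_sdiff_add_inter (μ := μ) (s := Prod.mk x ⁻¹' W)
    (isClosed_section hW x').measurableSet
  rw [inter_comm] at h2
  linarith [measureReal_section_eq hT hμ hW hTW x x']

include hT hμ hW hTW in
theorem section_ae_eq_preimage (x : X) :
    (Prod.mk x ⁻¹' W : Set X) =ᵐ[μ] T ⁻¹' (Prod.mk (T x) ⁻¹' W) := by
  refine ae_eq_of_subset_of_measure_ge (fun y hy => hTW _ hy) ?_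
    (isClosed_section hW x).nullMeasurableSet (measure_ne_top _ _)
  rw [hμ.measure_preimage (isClosed_section hW _).nullMeasurableSet]
  exact ((measureReal_eq_measureReal_iff).1 (measureReal_section_eq hT hμ hW hTW (T x) x)).le

/-- In a `Q`-realizable minimal system, the sections of a closed forward invariant set of pairs
agree up to null sets. -/
theorem IsRealizable.section_symmDiff_eq_zero (h : IsRealizable (regProx X) T)
    (hT : IsMinimal T) (hμ : MeasurePreserving T μ μ) (hW : IsClosed W)
    (hTW : ∀ p ∈ W, Prod.map T T p ∈ W) (x y : X) :
    μ.real ((Prod.mk x ⁻¹' W) ∆ (Prod.mk y ⁻¹' W)) = 0 := by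
  have symm : ∀ x y, μ.real ((Prod.mk x ⁻¹' W) ∆ (Prod.mk y ⁻¹' W)) =
      μ.real ((Prod.mk y ⁻¹' W) ∆ (Prod.mk x ⁻¹' W)) := fun x y => by rw [symmDiff_comm]
  have tri : ∀ x y z, μ.real ((Prod.mk x ⁻¹' W) ∆ (Prod.mk z ⁻¹' W)) ≤
      μ.real ((Prod.mk x ⁻¹' W) ∆ (Prod.mk y ⁻¹' W)) +
        μ.real ((Prod.mk y ⁻¹' W) ∆ (Prod.mk z ⁻¹' W)) :=
    fun x y z => measureReal_symmDiff_le _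
  refine h.eq_zero (D := fun x y => μ.real ((Prod.mk x ⁻¹' W) ∆ (Prod.mk y ⁻¹' W)))
    (fun x => by simp) (fun _ _ => measureReal_nonneg) symm tri
    (continuous_of_tendsto_diagonal symm tri
      (tendsto_measureReal_section_symmDiff hT hμ hW hTW)) (fun x y => ?_) x y
  rw [← hμ.measureReal_preimage ((isClosed_section hW _).measurableSet.symmDiff
    (isClosed_section hW _).measurableSet).nullMeasurableSet, preimage_symmDiff]
  exact measureReal_congr ((section_ae_eq_preimage hT hμ hW hTW x).symm.symmDiff
    (section_ae_eq_preimage hT hμ hW hTW y).symm)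

end Sections

/-- A minimal `Q`-realizable system is weakly mixing in the following sense: a closed forward
invariant set of pairs containing a product `U × V` of non-empty open sets contains `X × V`. -/
theorem IsRealizable.univ_prod_subset {X : Type*} [MetricSpace X] [CompactSpace X] {T : C(X, X)}
    (h : IsRealizable (regProx X) T) (hT : IsMinimal T) {W : Set (X × X)} (hW : IsClosed W)
    (hTW : ∀ p ∈ W, Prod.map T T p ∈ W) {U V : Set X} (hU : U.Nonempty) (hV : IsOpen V)
    (hUV : U ×ˢ V ⊆ W) : univ ×ˢ V ⊆ W := by
  obtain ⟨u, hu⟩ := hU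
  borelize X
  have : Nonempty X := ⟨u⟩
  obtain ⟨μ, _, hμ⟩ := exists_isProbabilityMeasure_measurePreserving T
  have := hT.isOpenPosMeasure hμ
  rintro ⟨x, v⟩ ⟨-, hv⟩
  have h0 : μ (V \ Prod.mk x ⁻¹' W) = 0 := by
    refine measure_mono_null (fun y hy => ?_) ((measureReal_eq_zero_iff).1
      (h.section_symmDiff_eq_zero (μ := μ) hT hμ hW hTW u x))
    exact Or.inl ⟨hUV ⟨hu, hy.1⟩, hy.2⟩
  -- An open null set is empty, which upgrades almost everywhere containment to containment.
  rw [(hV.sdiff (isClosed_section hW x)).measure_eq_zero_iff μ, sdiff_eq_empty] at h0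
  exact h0 hv

theorem IsFull.isRealizable {X : Type*} [MetricSpace X] [CompactSpace X] {T : C(X, X)}
    (h : IsFull (regProx X) T) : IsRealizable (regProx X) T := by
  refine Setoid.eq_top_iff.2 fun x y => (icer_isLeast T _).1.2 (x, y) ?_
  rw [h]
  trivial

theorem IsRealizable.isFull {X : Type*} [MetricSpace X] [CompactSpace X] {T : C(X, X)}
    (h : IsRealizable (regProx X) T) (hT : IsMinimal T) : IsFull (regProx X) T := by
  refine eq_univ_of_forall fun ⟨x, y⟩ ε hε => ?_
  let O : Set (X × X) := ⋃ n : ℕ, (Prod.map T T)^[n] '' (Metric.ball x ε ×ˢ Metric.ball y ε)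
  have hO : MapsTo (Prod.map T T) O O := by
    rintro p hp
    obtain ⟨n, q, hq, rfl⟩ := mem_iUnion.1 hp
    exact mem_iUnion.2 ⟨n + 1, q, hq, Function.iterate_succ_apply' _ _ _⟩
  -- Only the first coordinate is moved, from the ball around `x` to `y`.
  have hy : (y, y) ∈ closure O := by
    refine h.univ_prod_subset hT isClosed_closure
      (hO.closure (T.continuous.prodMap T.continuous)) ⟨x, Metric.mem_ball_self hε⟩
      Metric.isOpen_ball (fun p hp => subset_closure (mem_iUnion.2 ⟨0, p, hp, rfl⟩))
      ⟨mem_univ _, Metric.mem_ball_self hε⟩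
  obtain ⟨p, hp, hpy⟩ := Metric.mem_closure_iff.1 hy (ε / 2) (half_pos hε)
  obtain ⟨n, ⟨x', y'⟩, ⟨hx', hy'⟩, rfl⟩ := mem_iUnion.1 hp
  rw [Prod.map_iterate, Prod.dist_eq, max_lt_iff] at hpy
  refine ⟨x', y', n, (Metric.mem_ball'.1 hx').le, (Metric.mem_ball'.1 hy').le, ?_⟩
  have := dist_triangle_left (T^[n] x') (T^[n] y') y
  simp only [Prod.map_apply] at hpy
  linarith

end TDS

theorem proposition4p11 {X : Type*} [MetricSpace X] [CompactSpace X] (T : C(X, X))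
    (hT : TDS.IsMinimal T) :
    TDS.IsFull (TDS.regProx X) T ↔ TDS.IsRealizable (TDS.regProx X) T :=
  ⟨TDS.IsFull.isRealizable, fun h => h.isFull hT⟩
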